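/- Let $d\ge 1$, $k\ge 0$ and $N\ge 0$ be integers, let $\kappa>0$ and $c\in\mathbb R$. Then there is a constant $C>0$, depending only on $d,k,\kappa,N,c$, such that the following holds. Let $\mathcal T_{h,0}$ be a finite conforming mesh of closed $d$-simplices in $\mathbb R^d$ (any two elements meet in a common face or not at all), quasi-uniform with mesh parameter $h>0$ in the sense that every element has diameter at most $h$ and contains a ball of radius $\kappa h$. Let $\Omega_0=\bigcup_{T\in\mathcal T_{h,0}}T$, let $\Omega\subset\Omega_0$ be closed, and let $\mathcal T_h=\{T\in\mathcal T_{h,0}: T\cap\Omega\ne\emptyset\}$ and $\Omega_h=\bigcup_{T\in\mathcal T_h}T$. Let $V_h=V_{h,0}|_{\Omega_h}$, where $V_{h,0}=\{v\in C^0(\Omega_0): v|_T\in\mathbb P_k(T)\ \forall T\in\mathcal T_{h,0}\}$ and $\mathbb P_k$ denotes polynomials of total degree at most $k$. For $\gamma\in(0,1]$ let $\mathcal T_h^L=\{T\in\mathcal T_h: |T\cap\Omega|\ge\gamma|T|\}$ and $\mathcal T_h^S=\mathcal T_h\setminus\mathcal T_h^L$ be the large and the small elements, and let $S_h:\mathcal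 T_h^S\to\mathcal T_h^L$ be a map. For $v\in V_h$ and $T_1,T_2\in\mathcal T_h$ let $[v]_{T_1,T_2}=v_1^e-v_2^e\in\mathbb P_k(\mathbb R^d)$, where $v_i^e\in\mathbb P_k(\mathbb R^d)$ is the polynomial that agrees with $v$ on $T_i$. Write $\|w\|_X=(\int_X|w|^2\,dx)^{1/2}$. Let $\mathcal S\subset\mathcal T_h^S$ be a set of small elements (those that occur in the stabilization), and assume A2: for every $T\in\mathcal S$ there is given a path $\mathcal P_h(T,S_h(T))=(T_1,\dots,T_n)$ of elements of $\mathcal T_h$ with $T_1=T$, $T_n=S_h(T)$ and $n\le N$, in which any two consecutive elements are distinct and share a $(d-1)$-dimensional face. Then for all $T\in\mathcal S$ and $T_0\in\mathcal T_h$ such that $T_0\cup T\cup S_h(T)$ is contained in a ball of radius $\delta\le c\,h$, and for all $v\in V_h$, $$\|[v]_{T,S_h(T)}\|_{T_0}\le C\,h\,\|\nabla v\|_{\mathcal P_h(T,S_h(T))},$$ where the norm on the right is taken over the union of the elements of the path. -/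

import Mathlib

open MeasureTheory

noncomputable section

namespace GhostPenalty

/-- Euclidean space `ℝ^d`. -/
abbrev E (d : ℕ) : Type := EuclideanSpace ℝ (Fin d)

/-- The space `P_k(ℝ^d)` of real polynomials in `d` variables of total degree at most `k`. -/
abbrev Poly (d k : ℕ) : Submodule ℝ (MvPolynomial (Fin d) ℝ) :=
  MvPolynomial.restrictTotalDegree (Fin d) ℝ k

/-- The value of a polynomial at a point of `ℝ^d`. -/
def evalAt {d : ℕ} (p : MvPolynomial (Fin d) ℝ) (x : E d) : ℝ :=
  MvPolynomial.eval (fun i => x i) p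

/-- The closed simplex with vertex set `T`. Elements of a mesh are recorded by their vertices. -/
def cell {d : ℕ} (T : Finset (E d)) : Set (E d) := convexHull ℝ (T : Set (E d))

/-- A conforming simplicial mesh: a finite simplicial complex in `ℝ^d`, all of whose faces are
faces of `d`-dimensional simplices. -/
structure Mesh (d : ℕ) where
  complex : Geometry.SimplicialComplex ℝ (E d)
  finite : complex.faces.Finite
  pure : ∀ s ∈ complex.faces, ∃ t ∈ complex.faces, s ⊆ t ∧ t.card = d + 1

namespace Mesh

variable {d : ℕ}

/-- The elements of the mesh: its `d`-dimensional simplices. -/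
def elements (M : Mesh d) : Set (Finset (E d)) :=
  {T | T ∈ M.complex.faces ∧ T.card = d + 1}

/-- The polygonal domain `Ω₀` covered by the mesh. -/
def domain (M : Mesh d) : Set (E d) := ⋃ T ∈ M.elements, cell T

/-- Quasi-uniformity with mesh parameter `h` and constant `κ`: every element has diameter at
most `h` and contains a ball of radius `κ h`. -/
def QuasiUniform (M : Mesh d) (κ h : ℝ) : Prop :=
  ∀ T ∈ M.elements, Metric.diam (cell T) ≤ h ∧ ∃ x, Metric.ball x (κ * h) ⊆ cell T

/-- The active mesh `T_h`: the elements that meet `Ω`. -/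
def active (M : Mesh d) (Ω : Set (E d)) : Set (Finset (E d)) :=
  {T | T ∈ M.elements ∧ (cell T ∩ Ω).Nonempty}

/-- The domain `Ω_h` covered by the active mesh. -/
def activeDomain (M : Mesh d) (Ω : Set (E d)) : Set (E d) := ⋃ T ∈ M.active Ω, cell T

/-- The large elements `T_h^L`: active elements `T` with `|T ∩ Ω| ≥ γ |T|`. -/
def large (M : Mesh d) (Ω : Set (E d)) (γ : ℝ) : Set (Finset (E d)) :=
  {T | T ∈ M.active Ω ∧ γ * volume.real (cell T) ≤ volume.real (cell T ∩ Ω)}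

/-- The small elements `T_h^S`: the active elements that are not large. -/
def small (M : Mesh d) (Ω : Set (E d)) (γ : ℝ) : Set (Finset (E d)) :=
  M.active Ω \ M.large Ω γ

/-- The finite element space `V_{h,0}`: functions continuous on `Ω₀` and equal to a polynomial of
degree at most `k` on each element. Functions are defined on all of `ℝ^d`, but only their values
on `Ω₀` matter. -/
def space₀ (M : Mesh d) (k : ℕ) : Set (E d → ℝ) :=
  {v | ContinuousOn v M.domain ∧
    ∀ T ∈ M.elements, ∃ p ∈ Poly d k, ∀ x ∈ cell T, v x = evalAt p x}

/-- The active finite element space `V_h = V_{h,0}|_{Ω_h}`: functions that agree on `Ω_h` with a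
member of `V_{h,0}`. -/
def activeSpace (M : Mesh d) (Ω : Set (E d)) (k : ℕ) : Set (E d → ℝ) :=
  {v | ∃ w ∈ M.space₀ k, Set.EqOn v w (M.activeDomain Ω)}

/-- `P` lists the elements of a path in the active mesh that starts in `T`, ends in `T'`, and in
which consecutive elements are neighbors across a common face. -/
structure IsFacePath (M : Mesh d) (Ω : Set (E d)) (T T' : Finset (E d))
    (P : List (Finset (E d))) : Prop where
  mem_active : ∀ K ∈ P, K ∈ M.active Ω
  head : P.head? = some T
  last : P.getLast? = some T'
  /-- Consecutive elements are distinct and share a `(d-1)`-dimensional face (`d` vertices). -/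
  chain : P.IsChain fun K K' => K ≠ K' ∧ ∃ F : Finset (E d), F.card = d ∧ F ⊆ K ∧ F ⊆ K'

/-- Assumption A2 for the map `Sh` from small to large elements, uniformly over the small elements
in `S` (those that occur in the stabilization): `P T` is a path of face neighboring active
elements from `T` to `Sh T` with at most `N` elements. -/
def AssumptionA2 (M : Mesh d) (Ω : Set (E d)) (γ : ℝ) (Sh : M.small Ω γ → M.large Ω γ)
    (S : Set (M.small Ω γ)) (P : M.small Ω γ → List (Finset (E d))) (N : ℕ) : Prop :=
  ∀ T ∈ S, M.IsFacePath Ω T (Sh T) (P T) ∧ (P T).length ≤ N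

end Mesh

/-- The subset of `ℝ^d` covered by a path of elements. -/
def pathRegion {d : ℕ} (P : List (Finset (E d))) : Set (E d) := ⋃ T ∈ P, cell T

open Classical in
/-- The canonical extension `(v|_T)^e`: the polynomial of degree at most `k` that agrees with `v`
on the simplex `T` (unique if `T` is nondegenerate; `0` if there is none). -/
def polyExt {d : ℕ} (k : ℕ) (v : E d → ℝ) (T : Finset (E d)) : MvPolynomial (Fin d) ℝ :=
  if H : ∃ p ∈ Poly d k, ∀ x ∈ cell T, v x = evalAt p x then H.choose else 0

/-- The jump `[v]_{T₁,T₂} = v₁^e - v₂^e`, a polynomial on `ℝ^d`. -/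
def jump {d : ℕ} (k : ℕ) (v : E d → ℝ) (T₁ T₂ : Finset (E d)) : MvPolynomial (Fin d) ℝ :=
  polyExt k v T₁ - polyExt k v T₂

/-- The `L²` norm over the set `X` of a real- or vector-valued function. -/
def normL2 {d : ℕ} {F : Type*} [NormedAddCommGroup F] (X : Set (E d)) (f : E d → F) : ℝ :=
  Real.sqrt (∫ x in X, ‖f x‖ ^ 2)

end GhostPenalty

end

namespace GhostPenalty

/-! The jump telescopes along the path. Two neighbors `K`, `K'` share a vertex `y`, where their
polynomials `q`, `q'` agree, so `q x - q' x = (q x - q y) - (q' x - q' y)`: only oscillations of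
single polynomials occur, and one common point is enough. Each oscillation, on a ball of radius `R
h` about the center `a` of the ball inscribed in `K`, is at most `C h^(1 - d/2)` times the `L²` norm
of the gradient on the inscribed ball (`exists_evalAt_sub_mul_sqrt_le`). On a reference ball this is
finite-dimensionality: a polynomial with zero gradient there is constant. Scaling gives the power of
`h`. On the inscribed ball the gradient is that of `v`, so the path norm bounds it.
`abs_sub_getLast_le` sums at most `N` such steps; integrating the pointwise bound over `T₀`, of
volume `O(h^d)`, removes `h^(-d/2)`. -/

/-- A linear map on a finite-dimensional space is bounded by any other linear map with a smaller
kernel. -/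
theorem exists_norm_le_mul_norm_of_ker_le_ker {V E₁ E₂ : Type*} [AddCommGroup V] [Module ℝ V]
    [Module.Finite ℝ V] [NormedAddCommGroup E₁] [NormedSpace ℝ E₁] [NormedAddCommGroup E₂]
    [NormedSpace ℝ E₂] (f : V →ₗ[ℝ] E₁) (g : V →ₗ[ℝ] E₂)
    (hfg : LinearMap.ker f ≤ LinearMap.ker g) :
    ∃ C : ℝ, 0 < C ∧ ∀ v, ‖g v‖ ≤ C * ‖f v‖ := by
  -- `g` factors through the range of `f`, which is finite-dimensional, so the factor is continuous.
  let φ : LinearMap.range f →ₗ[ℝ] E₂ :=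
    ((LinearMap.ker f).liftQ g hfg).comp f.quotKerEquivRange.symm.toLinearMap
  have hφ : ∀ v, φ ⟨f v, LinearMap.mem_range_self f v⟩ = g v := fun v => by
    have : f.quotKerEquivRange.symm ⟨f v, LinearMap.mem_range_self f v⟩
        = (LinearMap.ker f).mkQ v := by
      rw [LinearEquiv.symm_apply_eq]; rfl
    simp [φ, this]
  let Φ := LinearMap.toContinuousLinearMap φ
  refine ⟨‖Φ‖ + 1, by positivity, fun v => ?_⟩
  have h := Φ.le_opNorm ⟨f v, LinearMap.mem_range_self f v⟩
  have h' : Φ ⟨f v, LinearMap.mem_range_self f v⟩ = g v := hφ v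
  rw [h'] at h
  exact h.trans (mul_le_mul_of_nonneg_right (by linarith) (norm_nonneg _))

/-! ### Oscillation against gradient on a reference ball -/

variable {d k : ℕ}

theorem evalAt_add (p q : MvPolynomial (Fin d) ℝ) : evalAt (p + q) = evalAt p + evalAt q := by
  ext x; simp [evalAt]

theorem evalAt_sub (p q : MvPolynomial (Fin d) ℝ) (x : E d) :
    evalAt (p - q) x = evalAt p x - evalAt q x := by
  simp [evalAt]

theorem evalAt_smul (r : ℝ) (p : MvPolynomial (Fin d) ℝ) : evalAt (r • p) = r • evalAt p := by
  ext x; simp [evalAt]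

theorem analyticOnNhd_evalAt (p : MvPolynomial (Fin d) ℝ) :
    AnalyticOnNhd ℝ (evalAt p) Set.univ :=
  fun x _ => AnalyticAt.aeval_mvPolynomial (f := fun (y : E d) i => y i)
    (fun i => (EuclideanSpace.proj i : E d →L[ℝ] ℝ).analyticAt x) p

theorem contDiff_evalAt (p : MvPolynomial (Fin d) ℝ) : ContDiff ℝ 1 (evalAt p) :=
  (analyticOnNhd_evalAt p).contDiff

theorem differentiable_evalAt (p : MvPolynomial (Fin d) ℝ) : Differentiable ℝ (evalAt p) :=
  (contDiff_evalAt p).differentiable one_ne_zero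

theorem continuous_gradient_evalAt (p : MvPolynomial (Fin d) ℝ) :
    Continuous (gradient (evalAt p)) :=
  (InnerProductSpace.toDual ℝ (E d)).symm.continuous.comp
    ((contDiff_evalAt p).continuous_fderiv one_ne_zero)

theorem gradient_evalAt_add (p q : MvPolynomial (Fin d) ℝ) :
    gradient (evalAt (p + q)) = gradient (evalAt p) + gradient (evalAt q) := by
  ext1 x
  simp only [gradient, evalAt_add, Pi.add_apply]
  rw [fderiv_add (differentiable_evalAt p x) (differentiable_evalAt q x), map_add]

theorem gradient_evalAt_smul (r : ℝ) (p : MvPolynomial (Fin d) ℝ) :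
    gradient (evalAt (r • p)) = r • gradient (evalAt p) := by
  ext1 x
  simp only [gradient, evalAt_smul, Pi.smul_apply]
  rw [fderiv_const_smul (differentiable_evalAt p x), map_smulₛₗ]
  simp

theorem memLp_gradient_evalAt (p : MvPolynomial (Fin d) ℝ) (r : ℝ) :
    MemLp (gradient (evalAt p)) 2 (volume.restrict (Metric.ball (0 : E d) r)) :=
  (memLp_two_iff_integrable_sq_norm (continuous_gradient_evalAt p).aestronglyMeasurable).2
    (((continuous_gradient_evalAt p).norm.pow 2).continuousOn.integrableOn_compact
      (isCompact_closedBall (0 : E d) r) |>.mono_set Metric.ball_subset_closedBall)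

theorem norm_toLp_two_eq_normL2 {X : Set (E d)} {f : E d → E d}
    (hf : MemLp f 2 (volume.restrict X)) : ‖hf.toLp f‖ = normL2 X f := by
  rw [Lp.norm_toLp, hf.eLpNorm_eq_integral_rpow_norm two_ne_zero ENNReal.ofNat_ne_top,
    ENNReal.toReal_ofReal (by positivity), normL2, Real.sqrt_eq_rpow]
  norm_num

/-- The gradient of polynomials of bounded degree, as an `L²` function on a ball. -/
noncomputable def gradientLp (d k : ℕ) (r : ℝ) :
    Poly d k →ₗ[ℝ] Lp (E d) 2 (volume.restrict (Metric.ball (0 : E d) r)) where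
  toFun p := (memLp_gradient_evalAt (p : MvPolynomial (Fin d) ℝ) r).toLp _
  map_add' p q := by
    rw [← MemLp.toLp_add, MemLp.toLp_eq_toLp_iff, Submodule.coe_add, gradient_evalAt_add]
  map_smul' c p := by
    rw [RingHom.id_apply, ← MemLp.toLp_const_smul, MemLp.toLp_eq_toLp_iff, Submodule.coe_smul,
      gradient_evalAt_smul]

/-- The deviation of polynomials of bounded degree from their value at the origin, as a continuous
function on a closed ball. -/
noncomputable def deviation (d k : ℕ) (r : ℝ) :
    Poly d k →ₗ[ℝ] C(Metric.closedBall (0 : E d) r, ℝ) where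
  toFun p := ⟨fun x => evalAt (p : MvPolynomial (Fin d) ℝ) x - evalAt (p : MvPolynomial (Fin d) ℝ) 0,
    ((differentiable_evalAt _).continuous.comp continuous_subtype_val).sub continuous_const⟩
  map_add' p q := by
    ext x
    simp [evalAt_add]
    ring
  map_smul' c p := by
    ext x
    simp [evalAt_smul]
    ring

/-- Continuity turns a.e. into everywhere on the ball, which is connected, so the polynomial is
constant there; analyticity carries this to the whole space, hence to balls larger than the one of
radius `r`. -/
theorem evalAt_eq_of_gradient_eq_zero {r : ℝ} (hr : 0 < r) (p : MvPolynomial (Fin d) ℝ)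
    (h : gradient (evalAt p) =ᵐ[volume.restrict (Metric.ball (0 : E d) r)] 0) (x : E d) :
    evalAt p x = evalAt p 0 := by
  have h0 : Set.EqOn (gradient (evalAt p)) 0 (Metric.ball (0 : E d) r) :=
    Measure.eqOn_open_of_ae_eq h Metric.isOpen_ball (continuous_gradient_evalAt p).continuousOn
      continuousOn_const
  have hmem : (0 : E d) ∈ Metric.ball (0 : E d) r := Metric.mem_ball_self hr
  have hconst : Set.EqOn (evalAt p) (fun _ => evalAt p 0) (Metric.ball (0 : E d) r) :=
    fun y hy => Metric.isOpen_ball.is_const_of_fderiv_eq_zero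
      (convex_ball _ _).isPreconnected (differentiable_evalAt p).differentiableOn
      (fun z hz => by simp [← toDual_gradient, h0 hz]) hy hmem
  exact congrFun ((analyticOnNhd_evalAt p).eq_of_eventuallyEq analyticOnNhd_const
    (hconst.eventuallyEq_of_mem (Metric.isOpen_ball.mem_nhds hmem))) x

/-- On a reference ball, the oscillation of a polynomial is bounded by the `L²` norm of its
gradient over a possibly smaller ball. -/
theorem exists_evalAt_sub_le_normL2_gradient (d k : ℕ) {κ : ℝ} (hκ : 0 < κ) (R : ℝ) :
    ∃ C : ℝ, 0 < C ∧ ∀ p ∈ Poly d k, ∀ x ∈ Metric.closedBall (0 : E d) R,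
      ∀ y ∈ Metric.closedBall (0 : E d) R,
        |evalAt p x - evalAt p y| ≤ C * normL2 (Metric.ball 0 κ) (gradient (evalAt p)) := by
  obtain ⟨C, hC, hle⟩ := exists_norm_le_mul_norm_of_ker_le_ker (gradientLp d k κ)
    (deviation d k R) fun p hp => by
      rw [LinearMap.mem_ker] at hp ⊢
      have h : gradient (evalAt (p : MvPolynomial (Fin d) ℝ))
          =ᵐ[volume.restrict (Metric.ball (0 : E d) κ)] 0 :=
        (memLp_gradient_evalAt _ _).toLp_eq_toLp_iff MemLp.zero |>.1 (by
          rw [MemLp.toLp_zero]; exact hp)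
      ext x
      exact sub_eq_zero.2 (evalAt_eq_of_gradient_eq_zero hκ _ h x)
  refine ⟨2 * C, by positivity, fun p hp x hx y hy => ?_⟩
  have hp' := hle ⟨p, hp⟩
  rw [show ‖gradientLp d k κ ⟨p, hp⟩‖ = normL2 (Metric.ball 0 κ) (gradient (evalAt p)) from
    norm_toLp_two_eq_normL2 (memLp_gradient_evalAt p κ)] at hp'
  have key : ∀ z ∈ Metric.closedBall (0 : E d) R,
      |evalAt p z - evalAt p 0| ≤ C * normL2 (Metric.ball 0 κ) (gradient (evalAt p)) :=
    fun z hz => ((deviation d k R ⟨p, hp⟩).norm_coe_le_norm ⟨z, hz⟩).trans hp'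
  calc |evalAt p x - evalAt p y|
      = |(evalAt p x - evalAt p 0) - (evalAt p y - evalAt p 0)| := by ring_nf
    _ ≤ |evalAt p x - evalAt p 0| + |evalAt p y - evalAt p 0| := abs_sub _ _
    _ ≤ _ := by linarith [key x hx, key y hy]

/-! ### Scaling to size `h` -/

/-- The polynomial `y ↦ p (a + h y)`. -/
noncomputable def rescale (a : E d) (h : ℝ) (p : MvPolynomial (Fin d) ℝ) :
    MvPolynomial (Fin d) ℝ :=
  MvPolynomial.bind₁ (fun i => MvPolynomial.C (a i) + MvPolynomial.C h * MvPolynomial.X i) p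

theorem evalAt_rescale (a : E d) (h : ℝ) (p : MvPolynomial (Fin d) ℝ) (y : E d) :
    evalAt (rescale a h p) y = evalAt p (a + h • y) := by
  simp only [evalAt, rescale, MvPolynomial.eval, MvPolynomial.eval₂Hom_bind₁]
  simp

theorem rescale_mem_poly (a : E d) (h : ℝ) {p : MvPolynomial (Fin d) ℝ} (hp : p ∈ Poly d k) :
    rescale a h p ∈ Poly d k := by
  rw [MvPolynomial.mem_restrictTotalDegree] at hp ⊢
  have hlin : ∀ i, (MvPolynomial.C (a i) + MvPolynomial.C h * MvPolynomial.X i :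
      MvPolynomial (Fin d) ℝ).totalDegree ≤ 1 := fun i =>
    (MvPolynomial.totalDegree_add _ _).trans (max_le (by simp)
      ((MvPolynomial.totalDegree_mul _ _).trans (by simp)))
  rw [rescale, MvPolynomial.bind₁, MvPolynomial.aeval_def, MvPolynomial.eval₂_eq]
  refine MvPolynomial.totalDegree_finsetSum_le fun s hs => ?_
  refine (MvPolynomial.totalDegree_mul _ _).trans ?_
  have hle := (MvPolynomial.le_totalDegree hs).trans hp
  rw [MvPolynomial.algebraMap_eq, MvPolynomial.totalDegree_C, zero_add]
  refine (MvPolynomial.totalDegree_finsetProd _ _).trans (le_trans ?_ hle)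
  exact Finset.sum_le_sum fun i _ => (MvPolynomial.totalDegree_pow _ _).trans
    ((Nat.mul_le_mul_left _ (hlin i)).trans (by simp))

theorem gradient_rescale (a : E d) (h : ℝ) (p : MvPolynomial (Fin d) ℝ) (y : E d) :
    gradient (evalAt (rescale a h p)) y = h • gradient (evalAt p) (a + h • y) := by
  have hf : HasFDerivAt (fun y : E d => a + h • y) (h • ContinuousLinearMap.id ℝ (E d)) y :=
    ((hasFDerivAt_id y).const_smul h).const_add a
  have hc := (differentiable_evalAt p (a + h • y)).hasFDerivAt.comp y hf
  have he : evalAt (rescale a h p) = evalAt p ∘ fun y => a + h • y :=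
    funext (evalAt_rescale a h p)
  rw [he, gradient, gradient, hc.fderiv]
  rw [ContinuousLinearMap.comp_smul, ContinuousLinearMap.comp_id, map_smulₛₗ]
  simp

theorem setIntegral_ball_comp_add_smul (g : E d → ℝ) (a : E d) {h : ℝ} (hh : 0 < h) (r : ℝ) :
    ∫ y in Metric.ball (0 : E d) r, g (a + h • y)
      = (h ^ d)⁻¹ * ∫ y in Metric.ball a (h * r), g y := by
  rw [Measure.setIntegral_comp_smul_of_pos volume (fun y => g (a + y)) _ hh,
    finrank_euclideanSpace_fin, smul_eq_mul, smul_ball hh.ne', smul_zero, Real.norm_of_nonneg hh.le,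
    ← (measurePreserving_add_left volume a).setIntegral_preimage_emb
      (measurableEmbedding_addLeft a) g (Metric.ball a (h * r))]
  simp [preimage_add_ball]

/-- The scaled form of `exists_evalAt_sub_le_normL2_gradient`. -/
theorem exists_evalAt_sub_mul_sqrt_le (d k : ℕ) {κ : ℝ} (hκ : 0 < κ) (R : ℝ) :
    ∃ C : ℝ, 0 < C ∧ ∀ p ∈ Poly d k, ∀ (a : E d) (h : ℝ), 0 < h →
      ∀ x, dist x a ≤ R * h → ∀ y, dist y a ≤ R * h →
        |evalAt p x - evalAt p y| * √(h ^ d)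
          ≤ C * h * normL2 (Metric.ball a (κ * h)) (gradient (evalAt p)) := by
  obtain ⟨C, hC, H⟩ := exists_evalAt_sub_le_normL2_gradient d k hκ R
  refine ⟨C, hC, fun p hp a h hh x hx y hy => ?_⟩
  have hmem : ∀ z, dist z a ≤ R * h → h⁻¹ • (z - a) ∈ Metric.closedBall (0 : E d) R := by
    intro z hz
    rw [mem_closedBall_zero_iff, norm_smul, norm_inv, Real.norm_of_nonneg hh.le, ← dist_eq_norm,
      inv_mul_le_iff₀ hh, mul_comm]
    exact hz
  have hev : ∀ z, evalAt (rescale a h p) (h⁻¹ • (z - a)) = evalAt p z := by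
    intro z
    rw [evalAt_rescale, smul_inv_smul₀ hh.ne', add_sub_cancel]
  have hb := H _ (rescale_mem_poly a h hp) _ (hmem x hx) _ (hmem y hy)
  rw [hev, hev] at hb
  -- The chain rule gives the factor `h`; the Jacobian `h^(-d)` under the root cancels against `√(h
  -- ^ d)`.
  have hn : normL2 (Metric.ball 0 κ) (gradient (evalAt (rescale a h p))) * √(h ^ d)
      = h * normL2 (Metric.ball a (κ * h)) (gradient (evalAt p)) := by
    simp only [normL2, gradient_rescale, norm_smul, mul_pow, Real.norm_of_nonneg hh.le]
    rw [integral_const_mul,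
      setIntegral_ball_comp_add_smul (fun z => ‖gradient (evalAt p) z‖ ^ 2) a hh κ,
      ← Real.sqrt_mul' _ (by positivity), mul_comm h κ]
    rw [show ∀ I : ℝ, h ^ 2 * ((h ^ d)⁻¹ * I) * h ^ d = h ^ 2 * I from fun I => by field_simp,
      Real.sqrt_mul (by positivity), Real.sqrt_sq hh.le]
  calc _ ≤ C * normL2 (Metric.ball 0 κ) (gradient (evalAt (rescale a h p))) * √(h ^ d) := by
        gcongr
    _ = _ := by rw [mul_assoc, hn, mul_assoc]

/-! ### Finite element functions and paths of elements -/

variable {M : Mesh d} {Ω : Set (E d)} {v : E d → ℝ}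

theorem isCompact_cell (K : Finset (E d)) : IsCompact (cell K) :=
  K.finite_toSet.isCompact_convexHull ℝ

theorem polyExt_spec (hv : v ∈ M.activeSpace Ω k) {K : Finset (E d)} (hK : K ∈ M.active Ω) :
    polyExt k v K ∈ Poly d k ∧ ∀ x ∈ cell K, v x = evalAt (polyExt k v K) x := by
  obtain ⟨w, hw, hvw⟩ := hv
  obtain ⟨p, hp, hwp⟩ := hw.2 K hK.1
  have H : ∃ p ∈ Poly d k, ∀ x ∈ cell K, v x = evalAt p x :=
    ⟨p, hp, fun x hx => (hvw (Set.mem_biUnion hK hx)).trans (hwp x hx)⟩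
  rw [polyExt, dif_pos H]
  exact H.choose_spec

theorem gradient_eq_of_mem_interior {K : Finset (E d)} {p : MvPolynomial (Fin d) ℝ}
    (h : ∀ x ∈ cell K, v x = evalAt p x) {x : E d} (hx : x ∈ interior (cell K)) :
    gradient v x = gradient (evalAt p) x :=
  Filter.EventuallyEq.gradient_eq <|
    Filter.eventuallyEq_of_mem (mem_interior_iff_mem_nhds.1 hx) h

/-- The frontier of a convex set is null, so the gradient is a.e. that of a polynomial.
Integrability is what makes the integral over the path dominate the one over an inscribed ball. -/
theorem integrableOn_cell_sq_norm_gradient {K : Finset (E d)} {p : MvPolynomial (Fin d) ℝ}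
    (h : ∀ x ∈ cell K, v x = evalAt p x) :
    IntegrableOn (fun x => ‖gradient v x‖ ^ 2) (cell K) := by
  have hp : IntegrableOn (fun x => ‖gradient (evalAt p) x‖ ^ 2) (cell K) :=
    ((continuous_gradient_evalAt p).norm.pow 2).continuousOn.integrableOn_compact
      (isCompact_cell K)
  have hnull : volume (frontier (cell K)) = 0 := (convex_convexHull ℝ _).addHaar_frontier volume
  refine hp.congr_fun_ae ?_
  rw [Filter.EventuallyEq, ae_restrict_iff' (isCompact_cell K).measurableSet]
  filter_upwards [measure_eq_zero_iff_ae_notMem.1 hnull] with x hx hxK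
  rw [gradient_eq_of_mem_interior h]
  by_contra hint
  exact hx ⟨subset_closure hxK, hint⟩

theorem normL2_gradient_polyExt_le (hv : v ∈ M.activeSpace Ω k) {P : List (Finset (E d))}
    (hP : ∀ K ∈ P, K ∈ M.active Ω) {K : Finset (E d)} (hK : K ∈ P) {a : E d} {r : ℝ}
    (hball : Metric.ball a r ⊆ cell K) :
    normL2 (Metric.ball a r) (gradient (evalAt (polyExt k v K)))
      ≤ normL2 (pathRegion P) (gradient v) := by
  have hint : IntegrableOn (fun x => ‖gradient v x‖ ^ 2) (pathRegion P) :=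
    (integrableOn_finite_biUnion P.finite_toSet).2 fun K hK =>
      integrableOn_cell_sq_norm_gradient (polyExt_spec hv (hP K hK)).2
  refine Real.sqrt_le_sqrt ?_
  have hcongr : ∫ x in Metric.ball a r, ‖gradient (evalAt (polyExt k v K)) x‖ ^ 2
      = ∫ x in Metric.ball a r, ‖gradient v x‖ ^ 2 :=
    setIntegral_congr_fun Metric.isOpen_ball.measurableSet fun x hx => by
      rw [gradient_eq_of_mem_interior (polyExt_spec hv (hP K hK)).2
        (interior_maximal hball Metric.isOpen_ball hx)]
  rw [hcongr]
  exact setIntegral_mono_set hint (Filter.Eventually.of_forall fun x => by positivity)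
    (hball.trans (Set.subset_biUnion_of_mem (u := fun K => cell K) hK)).eventuallyLE

/-- Summation of the jumps along a path of neighbors: `q K` is a function that agrees with `v`
on the element `K` and has small oscillation near `K`. -/
theorem abs_sub_getLast_le {q : Finset (E d) → E d → ℝ} {h R s B : ℝ} (hd : 1 ≤ d) (hh : 0 < h)
    (hR : 1 ≤ R) (x : E d) (L : List (Finset (E d))) (K₀ : Finset (E d)) (ρ : ℝ)
    (hchain : (K₀ :: L).IsChain fun K K' =>
      K ≠ K' ∧ ∃ F : Finset (E d), F.card = d ∧ F ⊆ K ∧ F ⊆ K')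
    (hdiam : ∀ K ∈ K₀ :: L, ∀ y ∈ cell K, ∀ z ∈ cell K, dist y z ≤ h)
    (hq : ∀ K ∈ K₀ :: L, ∀ y ∈ cell K, v y = q K y)
    (hosc : ∀ K ∈ K₀ :: L, ∃ a ∈ cell K, ∀ x, dist x a ≤ R * h → ∀ y, dist y a ≤ R * h →
      |q K x - q K y| * s ≤ B)
    (hx : ∀ t ∈ cell K₀, dist x t ≤ ρ * h) (hρ : ρ + L.length ≤ R) (hs : 0 ≤ s) :
    |q K₀ x - q ((K₀ :: L).getLast (List.cons_ne_nil _ _)) x| * s ≤ 2 * L.length * B := by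
  induction L generalizing K₀ ρ with
  | nil => simp
  | cons K₁ L ih =>
    rw [List.isChain_cons_cons] at hchain
    obtain ⟨⟨-, F, hF, hF₀, hF₁⟩, hchain⟩ := hchain
    -- A common face has `d ≥ 1` vertices, hence a common point.
    obtain ⟨y, hy⟩ := Finset.card_pos.1 (by omega : 0 < F.card)
    have hy₀ : y ∈ cell K₀ := subset_convexHull ℝ _ (hF₀ hy)
    have hy₁ : y ∈ cell K₁ := subset_convexHull ℝ _ (hF₁ hy)
    have hK₁ : K₁ ∈ K₀ :: K₁ :: L := by simp
    -- Each step along the path costs one diameter, so `ρ` grows by one while the remaining length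
    -- drops by one.
    have hx₁ : ∀ t ∈ cell K₁, dist x t ≤ (ρ + 1) * h := fun t ht => by
      linarith [dist_triangle x y t, hx y hy₀, hdiam K₁ hK₁ y hy₁ t ht]
    rw [List.length_cons, Nat.cast_add_one] at hρ
    have hlen : (0 : ℝ) ≤ L.length := Nat.cast_nonneg _
    have key := ih K₁ (ρ + 1) hchain (fun K hK => hdiam K (List.mem_cons_of_mem _ hK))
      (fun K hK => hq K (List.mem_cons_of_mem _ hK))
      (fun K hK => hosc K (List.mem_cons_of_mem _ hK)) hx₁ (by linarith)
    obtain ⟨a₀, ha₀, h₀⟩ := hosc K₀ List.mem_cons_self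
    obtain ⟨a₁, ha₁, h₁⟩ := hosc K₁ hK₁
    have hle : h ≤ R * h := by nlinarith
    have e₀ := h₀ x ((hx a₀ ha₀).trans (by gcongr; linarith)) y
      ((hdiam K₀ List.mem_cons_self y hy₀ a₀ ha₀).trans hle)
    have e₁ := h₁ x ((hx₁ a₁ ha₁).trans (by gcongr; linarith)) y
      ((hdiam K₁ hK₁ y hy₁ a₁ ha₁).trans hle)
    have hyy : q K₀ y = q K₁ y := by
      rw [← hq K₀ List.mem_cons_self y hy₀, hq K₁ hK₁ y hy₁]
    rw [List.getLast_cons_cons, List.length_cons, Nat.cast_add_one]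
    set z := q ((K₁ :: L).getLast (List.cons_ne_nil _ _)) x
    have htri : |q K₀ x - z| ≤ |q K₀ x - q K₀ y| + |q K₁ x - q K₁ y| + |q K₁ x - z| := by
      have e : q K₀ x - z = (q K₀ x - q K₀ y) - (q K₁ x - q K₁ y) + (q K₁ x - z) := by
        rw [hyy]; ring
      rw [e]
      exact (abs_add_le _ _).trans (add_le_add_left (abs_sub _ _) _)
    nlinarith [mul_le_mul_of_nonneg_right htri hs]

/-- The volume of `X` is at most `h^d` times that of the unit ball, which absorbs the weight `√(h ^
d)`. -/
theorem normL2_le_of_forall_abs_mul_sqrt_le {X : Set (E d)} {h B : ℝ} (hh : 0 < h) {a : E d}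
    (hX : X ⊆ Metric.closedBall a h) {f : E d → ℝ} (hB : 0 ≤ B)
    (hf : ∀ x ∈ X, |f x| * √(h ^ d) ≤ B) :
    normL2 X f ≤ B * √(volume.real (Metric.ball (0 : E d) 1)) := by
  have hs : 0 < √(h ^ d) := Real.sqrt_pos.2 (by positivity)
  have hfin : volume (Metric.closedBall a h) < ⊤ := measure_closedBall_lt_top
  have hvol : volume.real X ≤ h ^ d * volume.real (Metric.ball (0 : E d) 1) := by
    refine (measureReal_mono hX hfin.ne).trans_eq ?_
    rw [Measure.addHaar_real_closedBall volume a hh.le, finrank_euclideanSpace_fin]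
  have hint := norm_setIntegral_le_of_norm_le_const (f := fun x => ‖f x‖ ^ 2)
    (C := (B / √(h ^ d)) ^ 2) ((measure_mono hX).trans_lt hfin) fun x hx => by
      rw [norm_pow, norm_norm]
      exact pow_le_pow_left₀ (norm_nonneg _) ((le_div_iff₀ hs).2 (hf x hx)) 2
  rw [normL2, Real.sqrt_le_left (by positivity), mul_pow, Real.sq_sqrt measureReal_nonneg]
  calc ∫ x in X, ‖f x‖ ^ 2 ≤ (B / √(h ^ d)) ^ 2 * volume.real X := (le_abs_self _).trans hint
    _ ≤ (B / √(h ^ d)) ^ 2 * (h ^ d * volume.real (Metric.ball (0 : E d) 1)) := by gcongr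
    _ = _ := by
      rw [div_pow, Real.sq_sqrt (by positivity)]
      field_simp

end GhostPenalty

open GhostPenalty in
/-- The classical gradient used on the right exists in the interior of each element, hence almost
everywhere on the path, and is there the weak gradient of the finite element function. -/
theorem lemma3p2 (d : ℕ) (hd : 1 ≤ d) (k : ℕ) (κ : ℝ) (hκ : 0 < κ) (N : ℕ) (c : ℝ) :
    ∃ C : ℝ, 0 < C ∧
      ∀ (M : Mesh d) (h : ℝ), 0 < h → M.QuasiUniform κ h →
      ∀ Ω : Set (E d), IsClosed Ω → Ω ⊆ M.domain →
      ∀ γ : ℝ, 0 < γ → γ ≤ 1 →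
      ∀ (Sh : M.small Ω γ → M.large Ω γ) (S : Set (M.small Ω γ))
        (P : M.small Ω γ → List (Finset (E d))), M.AssumptionA2 Ω γ Sh S P N →
      ∀ T ∈ S, ∀ T₀ ∈ M.active Ω,
      ∀ (z : E d) (δ : ℝ), δ ≤ c * h →
        cell T₀ ∪ cell T ∪ cell (Sh T : Finset (E d)) ⊆ Metric.closedBall z δ →
      ∀ v ∈ M.activeSpace Ω k,
        normL2 (cell T₀) (evalAt (jump k v T (Sh T)))
          ≤ C * h * normL2 (pathRegion (P T)) (gradient v) := by
  -- In units of `h`: `2|c|` bounds the distance from `T₀` to points of `T`, `N` allows for the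
  -- path, and `1` ensures `R ≥ 1`.
  obtain ⟨C, hC, H⟩ := exists_evalAt_sub_mul_sqrt_le d k hκ (2 * |c| + N + 1)
  set ω := volume.real (Metric.ball (0 : E d) 1)
  -- The `+ 1` keeps the constant positive when `N = 0`.
  refine ⟨2 * N * C * √ω + 1, by positivity, ?_⟩
  intro M h hh hM Ω _ _ γ _ _ Sh S P hA2 T hT T₀ hT₀ z δ hδ hsub v hv
  obtain ⟨hpath, hlen⟩ := hA2 T hT
  set G := normL2 (pathRegion (P T)) (gradient v)
  have hG : 0 ≤ G := Real.sqrt_nonneg _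
  have hdiam : ∀ K ∈ M.active Ω, ∀ y ∈ cell K, ∀ z ∈ cell K, dist y z ≤ h :=
    fun K hK y hy z hz =>
      (Metric.dist_le_diam_of_mem (isCompact_cell K).isBounded hy hz).trans (hM K hK.1).1
  have hjump : ∀ x ∈ cell T₀,
      |evalAt (jump k v T (Sh T)) x| * √(h ^ d) ≤ 2 * N * (C * h * G) := by
    intro x hx
    obtain ⟨L, hL⟩ := List.head?_eq_some_iff.1 hpath.head
    have hact := hpath.mem_active
    have hlast := hpath.last
    have hchain := hpath.chain
    rw [hL, List.getLast?_eq_some_getLast (List.cons_ne_nil _ _), Option.some_inj] at hlast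
    have hosc : ∀ K ∈ P T, ∃ a ∈ cell K, ∀ x, dist x a ≤ (2 * |c| + N + 1) * h →
        ∀ y, dist y a ≤ (2 * |c| + N + 1) * h →
        |evalAt (polyExt k v K) x - evalAt (polyExt k v K) y| * √(h ^ d) ≤ C * h * G := by
      intro K hK
      obtain ⟨a, ha⟩ := (hM K (hact K hK).1).2
      refine ⟨a, ha (Metric.mem_ball_self (by positivity)), fun x hx y hy => ?_⟩
      refine (H _ (polyExt_spec hv (hact K hK)).1 a h hh x hx y hy).trans ?_
      gcongr
      exact normL2_gradient_polyExt_le hv hact hK ha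
    have hxT : ∀ t ∈ cell (T : Finset (E d)), dist x t ≤ 2 * |c| * h := fun t ht => by
      have h₁ := Metric.mem_closedBall.1 (hsub (Or.inl (Or.inl hx)))
      have h₂ := Metric.mem_closedBall.1 (hsub (Or.inl (Or.inr ht)))
      have h₃ := mul_le_mul_of_nonneg_right (le_abs_self c) hh.le
      linarith [dist_triangle_right x t z]
    have hlenL : (L.length : ℝ) ≤ N := by
      rw [hL, List.length_cons] at hlen
      exact_mod_cast (Nat.le_succ _).trans hlen
    rw [hL] at hact hchain hosc
    have key := abs_sub_getLast_le (q := fun K => evalAt (polyExt k v K)) hd hh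
      (by linarith [abs_nonneg c, Nat.cast_nonneg (α := ℝ) N]) x L T (2 * |c|) hchain
      (fun K hK => hdiam K (hact K hK)) (fun K hK => (polyExt_spec hv (hact K hK)).2) hosc hxT
      (by linarith) (Real.sqrt_nonneg _)
    rw [hlast] at key
    rw [jump, evalAt_sub]
    exact key.trans (by gcongr)
  obtain ⟨x₀, hx₀, -⟩ := hT₀.2
  -- The diameter bound puts `T₀` in the ball of radius `h` about any of its points.
  have hbound := normL2_le_of_forall_abs_mul_sqrt_le hh
    (fun x hx => hdiam T₀ hT₀ x hx x₀ hx₀) (by positivity) hjump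
  calc _ ≤ 2 * N * (C * h * G) * √ω := hbound
    _ ≤ (2 * N * C * √ω + 1) * h * G := by nlinarith [mul_nonneg hh.le hG]
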